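/- Call a sequence of integers $(k_j)_{j\ge 0}$ a base sequence if $0=k_0<k_1<k_2<\cdots$. Call a sequence $M=(M_j)_{j\ge 0}$ of positive reals a weight sequence if $M_0=1\le M_1\le \mu_2\le\mu_3\le\cdots$, where $\mu_j:=M_j/M_{j-1}$. Put $m_j:=M_j^{1/j}$ for $j\ge1$ and $m_0:=1$. The weight sequence $M$ has moderate growth if $\sup_{j,k\ge1}\bigl(M_{j+k}/(M_jM_k)\bigr)^{1/(j+k)}<\infty$. For real- or complex-valued functions on $\mathbb R^n$, the Gelfand–Shilov class $\mathcal S^{\{M\}}(\mathbb R^n)$ (resp. $\mathcal S^{(M)}(\mathbb R^n)$) is the set of all $f\in C^\infty(\mathbb R^n)$ such that there exist $\rho,\sigma>0$ such that (resp. for all $\rho,\sigma>0$) $$\sup_{\alpha,\beta\in\mathbb N^n}\ \sup_{x\in\mathbb R^n}\frac{|x^\alpha\partial^\beta f(x)|}{(\rho m_{|\alpha|})^{|\alpha|}(\sigma m_{|\beta|})^{|\beta|}}<\infty .$$ For base sequences $(k_j)$ and $(\ell_j)$, the lacunary Gelfand–Shilov class $\mathcal S^{\{M\}}_{(k_j),(\ell_j)}(\mathbb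 R^n)$ (resp. $\mathcal S^{(M)}_{(k_j),(\ell_j)}(\mathbb R^n)$) is the set of all $f\in C^\infty(\mathbb R^n)$ such that there exist $C,\rho,\sigma>0$ such that (resp. for all $\rho,\sigma>0$ there is $C>0$ such that) $$\max_{|\alpha|=k_j}\sup_{x}|x^\alpha f(x)|\le C(\rho m_{k_j})^{k_j}\quad\text{and}\quad \max_{|\beta|=\ell_j}\sup_{x}|\partial^\beta f(x)|\le C(\sigma m_{\ell_j})^{\ell_j}\qquad\text{for all } j\ge0 .$$ Theorem. Let $(k_j)$ and $(\ell_j)$ be base sequences and let $M$ be a weight sequence of moderate growth. Assume that $m_{k_{j+1}}/m_{k_j}$ and $m_{\ell_{j+1}}/m_{\ell_j}$, $j\ge0$, are bounded. Then: (a) $\mathcal S^{\{M\}}_{(k_j),(\ell_j)}(\mathbb R^n)=\mathcal S^{\{M\}}(\mathbb R^n)$ provided that $j/m_j$ is bounded. (b) $\mathcal S^{(M)}_{(k_j),(\ell_j)}(\mathbb R^n)=\mathcal S^{(M)}(\mathbb R^n)$ provided that $j/m_j\to0$ as $j\to\infty$. -/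

import Mathlib

open Set Filter Topology
open scoped ContDiff

/-- A base sequence: `0 = k 0 < k 1 < k 2 < ⋯`, a strictly increasing sequence of integers. -/
structure IsBaseSequence (k : ℕ → ℕ) : Prop where
  zero : k 0 = 0
  strictMono : StrictMono k

/-- A weight sequence: a positive sequence with `M 0 = 1 ≤ M 1 ≤ μ 2 ≤ μ 3 ≤ ⋯`,
where `μ k = M k / M (k - 1)` (note that `μ 1 = M 1`, since `M 0 = 1`). -/
structure IsWeightSequence (M : ℕ → ℝ) : Prop where
  pos : ∀ k, 0 < M k
  zero : M 0 = 1
  one_le : 1 ≤ M 1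
  quot_mono : ∀ k, M (k + 1) / M k ≤ M (k + 2) / M (k + 1)

/-- Moderate growth: `sup_{j, k ≥ 1} (M (j + k) / (M j * M k)) ^ (1 / (j + k)) < ∞`. -/
def HasModerateGrowth (M : ℕ → ℝ) : Prop :=
  ∃ C : ℝ, ∀ j k : ℕ, 1 ≤ j → 1 ≤ k →
    (M (j + k) / (M j * M k)) ^ (1 / ((j : ℝ) + (k : ℝ))) ≤ C

/-- The sequence `m j = (M j) ^ (1 / j)`. For `j = 0` the value is `1`. -/
noncomputable def weightRoot (M : ℕ → ℝ) (j : ℕ) : ℝ :=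
  M j ^ (1 / (j : ℝ))

/-- The length `|α| = α₁ + ⋯ + αₙ` of a multi-index. -/
def multiLength {n : ℕ} (α : Fin n → ℕ) : ℕ :=
  ∑ i, α i

/-- The monomial `x ^ α = x₁ ^ α₁ ⋯ xₙ ^ αₙ`. -/
noncomputable def multiMonomial {n : ℕ} (α : Fin n → ℕ) (x : EuclideanSpace ℝ (Fin n)) : ℝ :=
  ∏ i, x i ^ α i

/-- The first order partial derivative `∂ᵢ f`. -/
noncomputable def partialDeriv {𝕜 : Type*} [RCLike 𝕜] {n : ℕ} (i : Fin n)
    (f : EuclideanSpace ℝ (Fin n) → 𝕜) : EuclideanSpace ℝ (Fin n) → 𝕜 :=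
  fun x => fderiv ℝ f x (EuclideanSpace.single i 1)

/-- The partial derivative `∂ ^ β f = ∂₁ ^ β₁ ⋯ ∂ₙ ^ βₙ f` of multi-index order `β`
(used only for smooth `f`). -/
noncomputable def multiDeriv {𝕜 : Type*} [RCLike 𝕜] {n : ℕ} (β : Fin n → ℕ)
    (f : EuclideanSpace ℝ (Fin n) → 𝕜) : EuclideanSpace ℝ (Fin n) → 𝕜 :=
  (List.finRange n).foldr (fun i g => (partialDeriv i)^[β i] g) f

/-- The finiteness, for given `ρ` and `σ`, of the supremum over all `α`, `β`, `x` of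
`|x ^ α ∂ ^ β f (x)| / ((ρ m_{|α|}) ^ |α| (σ m_{|β|}) ^ |β|)`. -/
def GelfandShilovBound {𝕜 : Type*} [RCLike 𝕜] {n : ℕ} (M : ℕ → ℝ) (ρ σ : ℝ)
    (f : EuclideanSpace ℝ (Fin n) → 𝕜) : Prop :=
  ∃ C : ℝ, ∀ (α β : Fin n → ℕ) (x : EuclideanSpace ℝ (Fin n)),
    |multiMonomial α x| * ‖multiDeriv β f x‖ /
        ((ρ * weightRoot M (multiLength α)) ^ multiLength α *
          (σ * weightRoot M (multiLength β)) ^ multiLength β) ≤ C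

/-- The Gelfand–Shilov class of Roumieu type on `ℝⁿ`, of functions with values in `𝕜`. -/
def gelfandShilovRoumieu (𝕜 : Type*) [RCLike 𝕜] (n : ℕ) (M : ℕ → ℝ) :
    Set (EuclideanSpace ℝ (Fin n) → 𝕜) :=
  {f | ContDiff ℝ ∞ f ∧ ∃ ρ > 0, ∃ σ > 0, GelfandShilovBound M ρ σ f}

/-- The Gelfand–Shilov class of Beurling type on `ℝⁿ`, of functions with values in `𝕜`. -/
def gelfandShilovBeurling (𝕜 : Type*) [RCLike 𝕜] (n : ℕ) (M : ℕ → ℝ) :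
    Set (EuclideanSpace ℝ (Fin n) → 𝕜) :=
  {f | ContDiff ℝ ∞ f ∧ ∀ ρ > 0, ∀ σ > 0, GelfandShilovBound M ρ σ f}

/-- The lacunary estimates with constants `C`, `ρ`, `σ`: for all `j`,
`max_{|α| = k j} sup_x |x ^ α f (x)| ≤ C (ρ m_{k j}) ^ (k j)` and
`max_{|β| = l j} sup_x |∂ ^ β f (x)| ≤ C (σ m_{l j}) ^ (l j)`. -/
def LacunaryBound {𝕜 : Type*} [RCLike 𝕜] {n : ℕ} (M : ℕ → ℝ) (k l : ℕ → ℕ) (C ρ σ : ℝ)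
    (f : EuclideanSpace ℝ (Fin n) → 𝕜) : Prop :=
  ∀ j : ℕ,
    (∀ α : Fin n → ℕ, multiLength α = k j → ∀ x : EuclideanSpace ℝ (Fin n),
      |multiMonomial α x| * ‖f x‖ ≤ C * (ρ * weightRoot M (k j)) ^ k j) ∧
    (∀ β : Fin n → ℕ, multiLength β = l j → ∀ x : EuclideanSpace ℝ (Fin n),
      ‖multiDeriv β f x‖ ≤ C * (σ * weightRoot M (l j)) ^ l j)

/-- The lacunary Gelfand–Shilov class of Roumieu type. -/
def lacunaryGelfandShilovRoumieu (𝕜 : Type*) [RCLike 𝕜] (n : ℕ) (M : ℕ → ℝ) (k l : ℕ → ℕ) :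
    Set (EuclideanSpace ℝ (Fin n) → 𝕜) :=
  {f | ContDiff ℝ ∞ f ∧ ∃ C > 0, ∃ ρ > 0, ∃ σ > 0, LacunaryBound M k l C ρ σ f}

/-- The lacunary Gelfand–Shilov class of Beurling type. -/
def lacunaryGelfandShilovBeurling (𝕜 : Type*) [RCLike 𝕜] (n : ℕ) (M : ℕ → ℝ) (k l : ℕ → ℕ) :
    Set (EuclideanSpace ℝ (Fin n) → 𝕜) :=
  {f | ContDiff ℝ ∞ f ∧ ∀ ρ > 0, ∀ σ > 0, ∃ C > 0, LacunaryBound M k l C ρ σ f}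

/-! Only the inclusion of the lacunary class in the full class is hard: pure bounds at sparse orders
must give mixed bounds at all orders. For orders `a = |α|` and `b = |β|`, `exists_index` supplies
lacunary orders `Q ≥ 2a` and `N ≥ 2b` whose weight roots are comparable to `m_a` and `m_b`; this
uses moderate growth and the bounded ratios.

Near a point `x` the decay of order `Q` makes `f` smaller than some `ε` (`exists_local_bound`). A
local Landau–Kolmogorov inequality (`norm_iteratedDeriv_le_sqrt`) interpolates between `ε` and the
bound on derivatives of order `N`: since `2b ≤ N`, order `b` still carries a factor `√(C * ε)`, and
since `2a ≤ Q`, this root absorbs `|x|^a`. The constants must be exponential in the order; they come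
from a Bernstein–Walsh bound for Taylor polynomials, and polarization passes from directional to
partial derivatives at the same cost. The interpolation also leaves a term `N ^ b`, which the
hypothesis on `j / m_j` controls. -/

/-! ### Polynomials bounded on `[-1, 1]` -/

/-- The preimages are the roots `z ± s` of `w² - 2zw + 1`. Their product is `1`, so one has norm at
most `1`, and its inverse is `2z - w`. -/
theorem Complex.exists_joukowski_preimage (z : ℂ) {r : ℝ} (hz : ‖z‖ ≤ r) :
    ∃ w : ℂ, w ≠ 0 ∧ ‖w‖ ≤ 1 ∧ ‖w‖⁻¹ ≤ 1 + 2 * r ∧ z = (w + w⁻¹) / 2 := by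
  have hr : 0 ≤ r := (norm_nonneg z).trans hz
  obtain ⟨s, hs⟩ := IsAlgClosed.exists_pow_nat_eq (z ^ 2 - 1) (n := 2) (by norm_num)
  have key : ∀ w : ℂ, w ^ 2 - 2 * z * w + 1 = 0 → ‖w‖ ≤ 1 →
      ∃ w : ℂ, w ≠ 0 ∧ ‖w‖ ≤ 1 ∧ ‖w‖⁻¹ ≤ 1 + 2 * r ∧ z = (w + w⁻¹) / 2 := by
    intro w hw hw1
    have hw0 : w ≠ 0 := by
      rintro rfl
      simp at hw
    have hz' : z = (w + w⁻¹) / 2 := by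
      field_simp
      linear_combination -hw
    refine ⟨w, hw0, hw1, ?_, hz'⟩
    have h1 : w⁻¹ = 2 * z - w := by rw [hz']; ring
    calc ‖w‖⁻¹ = ‖w⁻¹‖ := (norm_inv w).symm
      _ = ‖2 * z - w‖ := by rw [h1]
      _ ≤ ‖2 * z‖ + ‖w‖ := norm_sub_le _ _
      _ ≤ 1 + 2 * r := by
        rw [norm_mul, Complex.norm_ofNat]
        linarith
  by_cases h : ‖z + s‖ ≤ 1
  · exact key (z + s) (by linear_combination hs) h
  · refine key (z - s) (by linear_combination hs) ?_
    have hmul : ‖z + s‖ * ‖z - s‖ = 1 := by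
      rw [← norm_mul, show (z + s) * (z - s) = 1 by linear_combination -hs, norm_one]
    have := norm_nonneg (z - s)
    nlinarith

/-- Bernstein–Walsh type bound on discs. -/
theorem Polynomial.norm_eval_le_of_norm_eval_le_on_Icc {p : Polynomial ℂ} {N : ℕ}
    (hp : p.natDegree ≤ N) {B : ℝ} (hB : ∀ t ∈ Icc (-1 : ℝ) 1, ‖p.eval (t : ℂ)‖ ≤ B)
    {z : ℂ} {r : ℝ} (hz : ‖z‖ ≤ r) : ‖p.eval z‖ ≤ (1 + 2 * r) ^ N * B := by
  have hB0 : 0 ≤ B := (norm_nonneg _).trans (hB 0 (by norm_num))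
  -- `F` is `w ^ N * p((w + w⁻¹) / 2)` with denominators cleared, hence entire. On the unit circle
  -- `(w + w⁻¹) / 2 = Re w` lies in `[-1, 1]`, so the maximum principle applies.
  set F : ℂ → ℂ := fun w =>
    ∑ i ∈ Finset.range (N + 1), p.coeff i * ((w ^ 2 + 1) / 2) ^ i * w ^ (N - i) with hF
  have hFeq : ∀ w : ℂ, w ≠ 0 → F w = w ^ N * p.eval ((w + w⁻¹) / 2) := by
    intro w hw
    rw [Polynomial.eval_eq_sum_range' (Nat.lt_succ_of_le hp), Finset.mul_sum]
    refine Finset.sum_congr rfl fun i hi => ?_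
    have hi' : i ≤ N := Nat.lt_succ_iff.mp (Finset.mem_range.mp hi)
    have h1 : w ^ N = w ^ (N - i) * w ^ i := by rw [← pow_add, Nat.sub_add_cancel hi']
    have h2 : (w ^ 2 + 1) / 2 = w * ((w + w⁻¹) / 2) := by field_simp
    rw [h1, h2, mul_pow]
    ring
  have hFd : Differentiable ℂ F := by
    rw [hF]
    fun_prop
  have hball : ∀ w : ℂ, ‖w‖ ≤ 1 → ‖F w‖ ≤ B := by
    intro w hw
    refine Complex.norm_le_of_forall_mem_frontier_norm_le (U := Metric.ball (0 : ℂ) 1)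
      Metric.isBounded_ball hFd.diffContOnCl ?_ ?_
    · intro u hu
      rw [frontier_ball _ one_ne_zero, mem_sphere_zero_iff_norm] at hu
      have hu0 : u ≠ 0 := by
        rintro rfl
        simp at hu
      have hre : (u + u⁻¹) / 2 = ((u.re : ℝ) : ℂ) := by
        rw [Complex.inv_eq_conj hu, Complex.re_eq_add_conj]
      rw [hFeq u hu0, norm_mul, norm_pow, hu, one_pow, one_mul, hre]
      refine hB _ ?_
      have := Complex.abs_re_le_norm u
      rw [hu] at this
      exact abs_le.mp this
    · rw [closure_ball _ one_ne_zero]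
      simpa using hw
  obtain ⟨w, hw0, hw1, hw2, rfl⟩ := Complex.exists_joukowski_preimage z hz
  have h := hball w hw1
  rw [hFeq w hw0, norm_mul, norm_pow] at h
  have hwpos : 0 < ‖w‖ := norm_pos_iff.mpr hw0
  have hr : 0 ≤ r := (norm_nonneg _).trans hz
  calc ‖p.eval ((w + w⁻¹) / 2)‖ = (‖w‖⁻¹) ^ N * (‖w‖ ^ N * ‖p.eval ((w + w⁻¹) / 2)‖) := by
        rw [← mul_assoc, ← mul_pow, inv_mul_cancel₀ hwpos.ne', one_pow, one_mul]
    _ ≤ (1 + 2 * r) ^ N * B := by gcongr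

theorem Polynomial.iteratedDeriv_eval (p : Polynomial ℂ) (s : ℕ) :
    iteratedDeriv s (fun z => p.eval z) = fun z => (Polynomial.derivative^[s] p).eval z := by
  induction s with
  | zero => simp
  | succ s ih =>
    rw [iteratedDeriv_succ, ih]
    funext z
    rw [Polynomial.deriv, Function.iterate_succ_apply']

/-- Cauchy's estimate on the circle of radius `s / N`: there `(1 + 2s/N)^N ≤ e^(2s)`, and `s! ≤ s^s`
cancels the `s^s` in the denominator. -/
theorem Polynomial.factorial_mul_norm_coeff_le {p : Polynomial ℂ} {N : ℕ}
    (hp : p.natDegree ≤ N) {B : ℝ} (hB : ∀ t ∈ Icc (-1 : ℝ) 1, ‖p.eval (t : ℂ)‖ ≤ B) (s : ℕ) :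
    (s.factorial : ℝ) * ‖p.coeff s‖ ≤ (Real.exp 2 * N) ^ s * B := by
  have hB0 : 0 ≤ B := (norm_nonneg _).trans (hB 0 (by norm_num))
  rcases lt_or_ge N s with hs | hs
  · rw [Polynomial.coeff_eq_zero_of_natDegree_lt (hp.trans_lt hs), norm_zero, mul_zero]
    positivity
  rcases Nat.eq_zero_or_pos s with rfl | hs0
  · have := hB 0 (by norm_num)
    simpa [Polynomial.coeff_zero_eq_eval_zero] using this
  have hsR : (0 : ℝ) < s := by exact_mod_cast hs0
  have hNR : (0 : ℝ) < N := by exact_mod_cast hs0.trans_le hs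
  have hr : (0 : ℝ) < s / N := by positivity
  have hc := Complex.norm_iteratedDeriv_le_of_forall_mem_sphere_norm_le (c := 0) s hr
    (f := fun z => p.eval z) p.differentiable.diffContOnCl
    (C := (1 + 2 * (s / N : ℝ)) ^ N * B) (fun z hz => by
      rw [mem_sphere_zero_iff_norm] at hz
      exact Polynomial.norm_eval_le_of_norm_eval_le_on_Icc hp hB hz.le)
  have h0 : iteratedDeriv s (fun z => p.eval z) 0 = (s.factorial : ℂ) * p.coeff s := by
    rw [Polynomial.iteratedDeriv_eval]
    simp only
    rw [← Polynomial.coeff_zero_eq_eval_zero, Polynomial.coeff_iterate_derivative]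
    simp [Nat.descFactorial_self]
  rw [h0, norm_mul, Complex.norm_natCast] at hc
  refine hc.trans ?_
  have hexp : (1 + 2 * (s / N : ℝ)) ^ N ≤ Real.exp 2 ^ s := by
    calc (1 + 2 * (s / N : ℝ)) ^ N ≤ (Real.exp (2 * (s / N))) ^ N := by
          gcongr
          linarith [Real.add_one_le_exp (2 * (s / N : ℝ))]
      _ = Real.exp 2 ^ s := by
          rw [← Real.exp_nat_mul, ← Real.exp_nat_mul]
          congr 1
          field_simp
  have hfac : (s.factorial : ℝ) ≤ (s : ℝ) ^ s := by exact_mod_cast Nat.factorial_le_pow s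
  rw [div_le_iff₀ (by positivity)]
  calc (s.factorial : ℝ) * ((1 + 2 * (s / N : ℝ)) ^ N * B)
      ≤ (s : ℝ) ^ s * (Real.exp 2 ^ s * B) := by gcongr
    _ = (Real.exp 2 * N) ^ s * B * (s / N) ^ s := by
        rw [div_pow, mul_pow]
        field_simp

/-! ### Landau–Kolmogorov inequalities on an interval -/

/-- On `[-L, L]` the Taylor polynomial of degree below `N` differs from `g` by at most `L^N K / N!`.
Rescaled to `[-1, 1]`, it is subject to the coefficient bound. -/
theorem abs_iteratedDeriv_le_of_bounds_real {g : ℝ → ℝ} (hg : ContDiff ℝ ∞ g) {L ε K : ℝ}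
    (hL : 0 < L) {N s : ℕ} (hs : s < N) (hε : ∀ t, |t| ≤ L → |g t| ≤ ε)
    (hK : ∀ t, |t| ≤ L → |iteratedDeriv N g t| ≤ K) :
    |iteratedDeriv s g 0| ≤ (Real.exp 2 * N / L) ^ s * (ε + L ^ N / N.factorial * K) := by
  have hε0 : 0 ≤ ε := (abs_nonneg _).trans (hε 0 (by simpa using hL.le))
  have hK0 : 0 ≤ K := (abs_nonneg _).trans (hK 0 (by simpa using hL.le))
  obtain ⟨n, rfl⟩ : ∃ n, N = n + 1 := ⟨N - 1, by omega⟩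
  set P : ℝ → ℝ := fun x =>
    ∑ i ∈ Finset.range (n + 1), ((i.factorial : ℝ)⁻¹ * x ^ i) * iteratedDeriv i g 0 with hP
  have hPb : ∀ x, |x| ≤ L → |P x| ≤ ε + L ^ (n + 1) / (n + 1).factorial * K := by
    intro x hx
    rcases eq_or_ne x 0 with rfl | hx0
    · have : P 0 = g 0 := by
        simp [hP, Finset.sum_range_succ']
      rw [this]
      have h1 := hε 0 hx
      have : 0 ≤ L ^ (n + 1) / (n + 1).factorial * K := by positivity
      linarith
    obtain ⟨y, hy, hxy⟩ := taylor_mean_remainder_lagrange_iteratedDeriv (n := n) hx0.symm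
      ((hg.of_le (by exact_mod_cast le_top)).contDiffOn)
    have hT : taylorWithinEval g n (uIcc 0 x) 0 x = P x := by
      rw [taylor_within_apply]
      refine Finset.sum_congr rfl fun i _ => ?_
      rw [sub_zero, smul_eq_mul, iteratedDerivWithin_eq_iteratedDeriv (uniqueDiffOn_uIcc hx0.symm)
        ((hg.of_le (by exact_mod_cast le_top)).contDiffAt) left_mem_uIcc]
    rw [hT, sub_zero] at hxy
    have hyL : |y| ≤ L := by
      have h1 := uIoo_subset_uIcc_self hy
      have h2 := abs_sub_left_of_mem_uIcc h1
      simp only [sub_zero] at h2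
      exact h2.trans hx
    have h3 : P x = g x - iteratedDeriv (n + 1) g y * x ^ (n + 1) / (n + 1).factorial := by
      linarith
    rw [h3]
    refine (abs_sub _ _).trans (add_le_add (hε x hx) ?_)
    rw [abs_div, abs_mul, abs_pow, Nat.abs_cast]
    calc |iteratedDeriv (n + 1) g y| * |x| ^ (n + 1) / (n + 1).factorial
        ≤ K * L ^ (n + 1) / (n + 1).factorial := by
          gcongr
          exact hK y hyL
      _ = _ := by ring
  set c : ℕ → ℝ := fun i => (i.factorial : ℝ)⁻¹ * L ^ i * iteratedDeriv i g 0 with hc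
  set p : Polynomial ℂ := ∑ i ∈ Finset.range (n + 1), Polynomial.monomial i ((c i : ℝ) : ℂ) with hp
  have hdeg : p.natDegree ≤ n + 1 := by
    refine Polynomial.natDegree_sum_le_of_forall_le _ _ fun i hi => ?_
    exact (Polynomial.natDegree_monomial_le _).trans (Finset.mem_range.mp hi).le
  have hcoeff : p.coeff s = ((c s : ℝ) : ℂ) := by
    rw [hp, Polynomial.finsetSum_coeff, Finset.sum_eq_single s]
    · simp
    · intro i _ hi
      rw [Polynomial.coeff_monomial, if_neg hi]
    · intro h
      exact absurd (Finset.mem_range.mpr hs) h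
  have heval : ∀ t : ℝ, p.eval (t : ℂ) = ((P (L * t) : ℝ) : ℂ) := by
    intro t
    rw [hp, Polynomial.eval_finsetSum, hP]
    push_cast
    refine Finset.sum_congr rfl fun i _ => ?_
    rw [Polynomial.eval_monomial, hc]
    push_cast
    ring
  have hmain := Polynomial.factorial_mul_norm_coeff_le hdeg
    (B := ε + L ^ (n + 1) / (n + 1).factorial * K) (fun t ht => by
      rw [heval, Complex.norm_real, Real.norm_eq_abs]
      refine hPb _ ?_
      rw [abs_mul, abs_of_pos hL]
      exact mul_le_of_le_one_right hL.le (abs_le.mpr ht)) s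
  rw [hcoeff, Complex.norm_real, Real.norm_eq_abs, hc] at hmain
  simp only [abs_mul, abs_inv, Nat.abs_cast, abs_pow, abs_of_pos hL] at hmain
  have hf : (s.factorial : ℝ) ≠ 0 := by positivity
  rw [mul_assoc, mul_inv_cancel_left₀ hf] at hmain
  rw [div_pow, div_mul_eq_mul_div, le_div_iff₀ (by positivity), mul_comm]
  exact hmain

/-- A norming functional for the derivative at `0` reduces to real values, where the Lagrange
remainder is available. -/
theorem norm_iteratedDeriv_le_of_bounds {𝕜 : Type*} [RCLike 𝕜] {g : ℝ → 𝕜}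
    (hg : ContDiff ℝ ∞ g) {L ε K : ℝ} (hL : 0 < L) {N s : ℕ} (hs : s < N)
    (hε : ∀ t, |t| ≤ L → ‖g t‖ ≤ ε) (hK : ∀ t, |t| ≤ L → ‖iteratedDeriv N g t‖ ≤ K) :
    ‖iteratedDeriv s g 0‖ ≤ (Real.exp 2 * N / L) ^ s * (ε + L ^ N / N.factorial * K) := by
  obtain ⟨φ, hφ1, hφ2⟩ := exists_dual_vector'' ℝ (iteratedDeriv s g 0)
  have hφ : ∀ i, iteratedDeriv i (fun t => φ (g t)) = fun t => φ (iteratedDeriv i g t) := by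
    intro i
    induction i with
    | zero => simp
    | succ i ih =>
      rw [iteratedDeriv_succ, ih, iteratedDeriv_succ]
      funext t
      have hd : DifferentiableAt ℝ (iteratedDeriv i g) t :=
        (hg.differentiable_iteratedDeriv i (by exact_mod_cast WithTop.coe_lt_top _)) t
      exact (φ.hasFDerivAt.comp_hasDerivAt t hd.hasDerivAt).deriv
  have hle : ∀ v : 𝕜, |φ v| ≤ ‖v‖ := fun v => by
    have := φ.le_opNorm v
    rw [Real.norm_eq_abs] at this
    nlinarith [norm_nonneg v]
  have h := abs_iteratedDeriv_le_of_bounds_real (g := fun t => φ (g t)) (φ.contDiff.comp hg) hL hs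
    (fun t ht => (hle _).trans (hε t ht)) (K := K)
    (fun t ht => by rw [hφ]; exact (hle _).trans (hK t ht))
  rw [hφ] at h
  simpa [hφ2] using h

/-- A local Landau–Kolmogorov inequality with exponential constants. -/
theorem norm_iteratedDeriv_le_sqrt {𝕜 : Type*} [RCLike 𝕜] {g : ℝ → 𝕜}
    (hg : ContDiff ℝ ∞ g) {ε C S : ℝ} (hε0 : 0 < ε) (hεC : ε ≤ C) (hS : 0 < S) {N b : ℕ}
    (hN : 1 ≤ N) (hb : 2 * b ≤ N) (hε : ∀ t, |t| ≤ 1 → ‖g t‖ ≤ ε)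
    (hK : ∀ t, |t| ≤ 1 → ‖iteratedDeriv N g t‖ ≤ C * S ^ N) :
    ‖iteratedDeriv b g 0‖ ≤ 2 * (Real.exp 3 * max S N) ^ b * √(C * ε) := by
  have hC : 0 < C := hε0.trans_le hεC
  have hNR : (0 : ℝ) < N := by exact_mod_cast hN
  set q : ℝ := (C / ε) ^ (1 / (N : ℝ)) with hq
  have hCε : 1 ≤ C / ε := (one_le_div hε0).mpr hεC
  have hq1 : 1 ≤ q := Real.one_le_rpow hCε (by positivity)
  have hqN : q ^ N = C / ε := by
    rw [hq, one_div, Real.rpow_inv_natCast_pow (by positivity) (by omega)]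
  -- The half-length `L = N / T` is at most `1`, and `T ≥ e S q` makes the Taylor remainder at most
  -- `ε`, because `N^N / N! ≤ e^N` and `q^N = C / ε`.
  set T : ℝ := max (Real.exp 1 * S * q) N with hT
  have hT0 : 0 < T := lt_max_of_lt_right hNR
  have hL0 : 0 < N / T := by positivity
  have hL1 : N / T ≤ 1 := (div_le_one hT0).mpr (le_max_right _ _)
  have h := norm_iteratedDeriv_le_of_bounds hg hL0 (N := N) (s := b) (by omega)
    (fun t ht => hε t (ht.trans hL1)) (fun t ht => hK t (ht.trans hL1))
  have h1 : Real.exp 2 * N / (N / T) = Real.exp 2 * T := by field_simp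
  have hrem : (N / T) ^ N / N.factorial * (C * S ^ N) ≤ ε := by
    have hfac : (N : ℝ) ^ N / N.factorial ≤ Real.exp 1 ^ N := by
      rw [← Real.exp_nat_mul, mul_one]
      exact Real.pow_div_factorial_le_exp _ hNR.le N
    calc (N / T) ^ N / N.factorial * (C * S ^ N)
        = ((N : ℝ) ^ N / N.factorial) * (S / T) ^ N * C := by
          rw [div_pow, div_pow]
          ring
      _ ≤ Real.exp 1 ^ N * (S / T) ^ N * C := by gcongr
      _ = (Real.exp 1 * S / T) ^ N * C := by rw [← mul_pow, mul_div_assoc]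
      _ ≤ (q⁻¹) ^ N * C := by
          gcongr
          rw [div_le_iff₀ hT0, inv_mul_eq_div, le_div_iff₀ (by positivity)]
          exact le_max_left _ _
      _ = ε := by
          rw [inv_pow, hqN]
          field_simp
  have hTle : T ≤ q * (Real.exp 1 * max S N) := by
    have he : 1 ≤ Real.exp 1 := Real.one_le_exp zero_le_one
    refine max_le ?_ ?_
    · calc Real.exp 1 * S * q = q * (Real.exp 1 * S) := by ring
        _ ≤ q * (Real.exp 1 * max S N) := by gcongr; exact le_max_left _ _
    · calc (N : ℝ) = 1 * (1 * N) := by ring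
        _ ≤ q * (Real.exp 1 * max S N) := by gcongr; exact le_max_right _ _
  have hqb : q ^ b * ε ≤ √(C * ε) := by
    refine Real.le_sqrt_of_sq_le ?_
    calc (q ^ b * ε) ^ 2 = q ^ (2 * b) * ε ^ 2 := by ring
      _ ≤ q ^ N * ε ^ 2 := by gcongr
      _ = C * ε := by
        rw [hqN]
        field_simp
  rw [h1] at h
  have hM0 : 0 < max S (N : ℝ) := lt_max_of_lt_right hNR
  calc ‖iteratedDeriv b g 0‖ ≤ _ := h
    _ ≤ (Real.exp 2 * (q * (Real.exp 1 * max S N))) ^ b * (ε + ε) := by gcongr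
    _ = 2 * (Real.exp 3 * max S N) ^ b * (q ^ b * ε) := by
      rw [show (3 : ℝ) = 2 + 1 by norm_num, Real.exp_add]
      simp only [mul_pow]
      ring
    _ ≤ _ := by gcongr

/-! ### Polarization, directional and partial derivatives -/

/-- Polarization: `∑_S (-1)^|S| T(v_S, …, v_S) = (-1)^b ∑_σ T(v_{σ 1}, …, v_{σ b})`,
where `v_S = ∑_{i ∈ S} v_i`. -/
theorem MultilinearMap.sum_powerset_neg_one_pow_smul {E F : Type*} [AddCommGroup E] [Module ℝ E]
    [AddCommGroup F] [Module ℝ F] {b : ℕ} (T : MultilinearMap ℝ (fun _ : Fin b => E) F)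
    (v : Fin b → E) :
    ∑ S : Finset (Fin b), (∏ _j ∈ S, (-1 : ℝ)) • T (fun _ => ∑ i ∈ S, v i) =
      (-1 : ℝ) ^ b • ∑ σ : Equiv.Perm (Fin b), T (fun i => v (σ i)) := by
  classical
  have h1 : ∀ S : Finset (Fin b), T (fun _ => ∑ i ∈ S, v i) =
      ∑ r : Fin b → Fin b, (if ∀ i, r i ∈ S then (1 : ℝ) else 0) • T (fun i => v (r i)) := by
    intro S
    rw [T.map_sum_finset (fun _ i => v i) (fun _ => S)]
    simp_rw [ite_smul, one_smul, zero_smul]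
    rw [← Finset.sum_filter]
    refine Finset.sum_congr ?_ fun _ _ => rfl
    ext r
    simp [Fintype.mem_piFinset]
  have h2 : ∀ r : Fin b → Fin b,
      ∑ S : Finset (Fin b), (∏ _j ∈ S, (-1 : ℝ)) * (if ∀ i, r i ∈ S then (1 : ℝ) else 0) =
        if Function.Surjective r then (-1) ^ b else 0 := by
    intro r
    -- With the indicator written as a product over the complement of `S`, the alternating sum is an
    -- expanded product over `j`, whose factor is `-1 + 1 = 0` at any `j` missed by `r`.
    have h3 : ∀ S : Finset (Fin b), (if ∀ i, r i ∈ S then (1 : ℝ) else 0) =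
        ∏ j ∈ Finset.univ \ S, (if j ∈ Set.range r then (0 : ℝ) else 1) := by
      intro S
      split_ifs with h
      · symm
        refine Finset.prod_eq_one fun j hj => if_neg ?_
        rintro ⟨i, rfl⟩
        simp [h i] at hj
      · push Not at h
        obtain ⟨i, hi⟩ := h
        symm
        refine Finset.prod_eq_zero (i := r i) ?_ (if_pos (Set.mem_range_self i))
        simpa using hi
    simp_rw [h3]
    rw [← Finset.powerset_univ, ← Finset.prod_add]
    split_ifs with h
    · rw [Finset.prod_congr rfl (g := fun _ => (-1 : ℝ))]
      · simp
      · intro j _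
        rw [if_pos (Set.mem_range.mpr (h j)), add_zero]
    · simp only [Function.Surjective, not_forall] at h
      obtain ⟨j, hj⟩ := h
      refine Finset.prod_eq_zero (i := j) (Finset.mem_univ _) ?_
      rw [if_neg (by simpa using hj)]
      norm_num
  simp_rw [h1, Finset.smul_sum, smul_smul]
  rw [Finset.sum_comm]
  simp_rw [← Finset.sum_smul, h2]
  symm
  refine Finset.sum_of_injOn (fun σ : Equiv.Perm (Fin b) => (σ : Fin b → Fin b)) ?_ ?_ ?_ ?_
  · exact fun σ _ τ _ h => DFunLike.coe_injective h
  · simp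
  · intro r _ hr
    rw [if_neg, zero_smul]
    intro hs
    refine hr ⟨Equiv.ofBijective r ⟨Finite.injective_iff_surjective.mpr hs, hs⟩, by simp, rfl⟩
  · intro σ _
    rw [if_pos σ.surjective]

section PartialDerivatives

variable {𝕜 : Type*} [RCLike 𝕜] {n : ℕ} {f : EuclideanSpace ℝ (Fin n) → 𝕜}

theorem ContDiff.partialDeriv (hf : ContDiff ℝ ∞ f) (i : Fin n) :
    ContDiff ℝ ∞ (partialDeriv i f) :=
  (hf.fderiv_right (m := ∞) (by simp)).clm_apply contDiff_const

theorem ContDiff.foldr_partialDeriv (hf : ContDiff ℝ ∞ f) (L : List (Fin n)) :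
    ContDiff ℝ ∞ (L.foldr _root_.partialDeriv f) := by
  induction L with
  | nil => exact hf
  | cons i L ih => exact ih.partialDeriv i

theorem partialDeriv_comm (hf : ContDiff ℝ ∞ f) (i j : Fin n) :
    partialDeriv i (partialDeriv j f) = partialDeriv j (partialDeriv i f) := by
  have hd : Differentiable ℝ (fderiv ℝ f) :=
    (hf.fderiv_right (m := ∞) (by simp)).differentiable (by simp)
  have key : ∀ (i j : Fin n) (x), partialDeriv i (partialDeriv j f) x =
      fderiv ℝ (fderiv ℝ f) x (EuclideanSpace.single i 1) (EuclideanSpace.single j 1) := by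
    intro i j x
    unfold partialDeriv
    rw [fderiv_clm_apply (hd x) (differentiableAt_const _)]
    simp
  funext x
  rw [key, key]
  exact (hf.contDiffAt.isSymmSndFDerivAt
    (by simpa using (WithTop.coe_le_coe.mpr le_top : ((2 : ℕ∞) : WithTop ℕ∞) ≤ ∞))).eq _ _

/-- `iteratedFDeriv` on basis vectors produces partial derivatives in arbitrary order, while
`multiDeriv` fixes one. -/
theorem List.Perm.foldr_partialDeriv_eq (hf : ContDiff ℝ ∞ f) {L L' : List (Fin n)}
    (h : L.Perm L') : L.foldr partialDeriv f = L'.foldr partialDeriv f := by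
  induction h with
  | nil => rfl
  | cons i _ ih => simp only [List.foldr_cons, ih]
  | swap i j L =>
    simp only [List.foldr_cons]
    exact partialDeriv_comm (hf.foldr_partialDeriv L) _ _
  | trans _ _ h1 h2 => exact h1.trans h2

/-- The list of coordinate directions described by a multi-index. -/
def multiIndexList (β : Fin n → ℕ) : List (Fin n) :=
  (List.finRange n).flatMap fun i => List.replicate (β i) i

theorem multiDeriv_eq_foldr (β : Fin n → ℕ) (f : EuclideanSpace ℝ (Fin n) → 𝕜) :
    multiDeriv β f = (multiIndexList β).foldr partialDeriv f := by
  unfold multiDeriv multiIndexList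
  induction List.finRange n with
  | nil => rfl
  | cons i L ih =>
    rw [List.foldr_cons, ih, List.flatMap_cons, List.foldr_append]
    generalize (List.flatMap (fun i => List.replicate (β i) i) L).foldr partialDeriv f = g
    induction β i with
    | zero => rfl
    | succ m ihm => rw [Function.iterate_succ_apply', ihm, List.replicate_succ, List.foldr_cons]

theorem length_multiIndexList (β : Fin n → ℕ) : (multiIndexList β).length = multiLength β := by
  simp [multiIndexList, multiLength, List.length_flatMap, Fin.sum_univ_def]

theorem count_multiIndexList (β : Fin n → ℕ) (i : Fin n) : (multiIndexList β).count i = β i := by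
  simp [multiIndexList, List.count_flatMap, Function.comp_def, List.count_replicate,
    ← Fin.sum_univ_def]

theorem foldr_partialDeriv_eq_multiDeriv (hf : ContDiff ℝ ∞ f) (L : List (Fin n)) :
    L.foldr partialDeriv f = multiDeriv (fun i => L.count i) f := by
  rw [multiDeriv_eq_foldr]
  refine List.Perm.foldr_partialDeriv_eq hf (List.perm_iff_count.mpr fun i => ?_)
  rw [count_multiIndexList]

theorem multiLength_count (L : List (Fin n)) : multiLength (fun i => L.count i) = L.length := by
  rw [← length_multiIndexList]
  refine (List.perm_iff_count.mpr fun i => ?_).length_eq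
  rw [count_multiIndexList]

theorem iteratedFDeriv_single_eq_foldr (hf : ContDiff ℝ ∞ f) {N : ℕ} (r : Fin N → Fin n)
    (x : EuclideanSpace ℝ (Fin n)) :
    iteratedFDeriv ℝ N f x (fun j => EuclideanSpace.single (r j) 1) =
      (List.ofFn r).foldr partialDeriv f x := by
  induction N generalizing x with
  | zero => simp
  | succ N ih =>
    have hd : DifferentiableAt ℝ (iteratedFDeriv ℝ N f) x :=
      (hf.differentiable_iteratedFDeriv (by exact_mod_cast WithTop.coe_lt_top _)) x
    rw [hd.iteratedFDeriv_succ_apply_left', List.ofFn_succ, List.foldr_cons]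
    conv_rhs => unfold partialDeriv
    congr 2
    funext y
    exact ih (fun j => r j.succ) y

theorem iteratedDeriv_comp_line (hf : ContDiff ℝ ∞ f) (x v : EuclideanSpace ℝ (Fin n)) (N : ℕ) :
    iteratedDeriv N (fun t : ℝ => f (x + t • v)) =
      fun t => iteratedFDeriv ℝ N f (x + t • v) (fun _ => v) := by
  induction N with
  | zero => simp
  | succ N ih =>
    rw [iteratedDeriv_succ, ih]
    funext t
    have hd : Differentiable ℝ (iteratedFDeriv ℝ N f) :=
      hf.differentiable_iteratedFDeriv (by exact_mod_cast WithTop.coe_lt_top _)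
    rw [(hd _).iteratedFDeriv_succ_apply_left']
    have hline : HasDerivAt (fun t : ℝ => x + t • v) v t := by
      simpa using ((hasDerivAt_id t).smul_const v).const_add x
    have hD : DifferentiableAt ℝ (fun y => iteratedFDeriv ℝ N f y (fun _ => v)) (x + t • v) := by
      have := (ContinuousMultilinearMap.apply ℝ (fun _ : Fin N => EuclideanSpace ℝ (Fin n)) 𝕜
        (fun _ => v)).differentiableAt.comp (x + t • v) (hd (x + t • v))
      exact this
    exact (hD.hasFDerivAt.comp_hasDerivAt t hline).deriv

/-- Expanding `v` in the basis gives coefficients of total mass `(∑ |v i|)^N ≤ 1`; the `ℓ¹`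
normalization avoids a factor `n^N`. -/
theorem norm_iteratedFDeriv_diagonal_le (hf : ContDiff ℝ ∞ f) {N : ℕ} {K : ℝ}
    {x : EuclideanSpace ℝ (Fin n)}
    (hK : ∀ β : Fin n → ℕ, multiLength β = N → ‖multiDeriv β f x‖ ≤ K)
    {v : EuclideanSpace ℝ (Fin n)} (hv : ∑ i, |v i| ≤ 1) (hK0 : 0 ≤ K) :
    ‖iteratedFDeriv ℝ N f x (fun _ => v)‖ ≤ K := by
  have hexp : v = ∑ i, v i • EuclideanSpace.single i (1 : ℝ) := by
    ext j
    simp [Finset.sum_apply, Pi.single_apply]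
  have h1 : iteratedFDeriv ℝ N f x (fun _ => v) = ∑ r : Fin N → Fin n,
      (∏ j, v (r j)) • iteratedFDeriv ℝ N f x (fun j => EuclideanSpace.single (r j) 1) := by
    conv_lhs => rw [hexp]
    rw [ContinuousMultilinearMap.map_sum]
    refine Finset.sum_congr rfl fun r _ => ?_
    rw [ContinuousMultilinearMap.map_smul_univ]
  rw [h1]
  calc ‖∑ r : Fin N → Fin n,
        (∏ j, v (r j)) • iteratedFDeriv ℝ N f x (fun j => EuclideanSpace.single (r j) 1)‖
      ≤ ∑ r : Fin N → Fin n, (∏ j, |v (r j)|) * K := by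
        refine norm_sum_le_of_le _ fun r _ => ?_
        rw [norm_smul, Real.norm_eq_abs, Finset.abs_prod]
        gcongr
        rw [iteratedFDeriv_single_eq_foldr hf, foldr_partialDeriv_eq_multiDeriv hf]
        exact hK _ (by rw [multiLength_count, List.length_ofFn])
    _ = (∑ i, |v i|) ^ N * K := by
        rw [← Finset.sum_mul, Fintype.sum_pow]
    _ ≤ 1 * K := by
        gcongr
        exact pow_le_one₀ (Finset.sum_nonneg fun _ _ => abs_nonneg _) hv
    _ = K := one_mul K

/-- Polarization writes `b! T v` through `2^b` diagonal values at vectors of `ℓ¹` norm at most `b`.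
Homogeneity costs `b^b`, and `b^b / b! ≤ e^b`. -/
theorem norm_multiDeriv_le_of_diagonal (hf : ContDiff ℝ ∞ f) {K : ℝ} (hK0 : 0 ≤ K)
    {x : EuclideanSpace ℝ (Fin n)} {β : Fin n → ℕ}
    (hK : ∀ v : EuclideanSpace ℝ (Fin n), ∑ i, |v i| ≤ 1 →
      ‖iteratedFDeriv ℝ (multiLength β) f x (fun _ => v)‖ ≤ K) :
    ‖multiDeriv β f x‖ ≤ (2 * Real.exp 1) ^ multiLength β * K := by
  obtain ⟨r, hr⟩ : ∃ r : Fin (multiLength β) → Fin n, List.ofFn r = multiIndexList β := by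
    rw [← length_multiIndexList]
    exact ⟨_, List.ofFn_get _⟩
  have h0 : multiDeriv β f x = iteratedFDeriv ℝ (multiLength β) f x
      (fun j => EuclideanSpace.single (r j) 1) := by
    rw [iteratedFDeriv_single_eq_foldr hf, hr, multiDeriv_eq_foldr]
  rw [h0]
  clear h0 hr
  generalize multiLength β = b at *
  set T := iteratedFDeriv ℝ b f x with hT
  set v : Fin b → EuclideanSpace ℝ (Fin n) := fun j => EuclideanSpace.single (r j) 1 with hv
  have hpol := T.toMultilinearMap.sum_powerset_neg_one_pow_smul v
  have hsymm : ∀ σ : Equiv.Perm (Fin b), T (fun i => v (σ i)) = T v := by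
    intro σ
    rw [hT, hv, iteratedFDeriv_single_eq_foldr hf, iteratedFDeriv_single_eq_foldr hf]
    exact congrFun ((Equiv.Perm.ofFn_comp_perm σ r).foldr_partialDeriv_eq hf) x
  simp only [ContinuousMultilinearMap.coe_coe, hsymm, Finset.sum_const, Finset.card_univ,
    Fintype.card_perm, Fintype.card_fin] at hpol
  have hdiag : ∀ S : Finset (Fin b), ‖T (fun _ => ∑ i ∈ S, v i)‖ ≤ (b : ℝ) ^ b * K := by
    intro S
    rcases Nat.eq_zero_or_pos b with hb | hb
    · subst hb
      have := hK 0 (by simp)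
      rw [Subsingleton.elim (fun _ : Fin 0 => (0 : EuclideanSpace ℝ (Fin n)))
        (fun _ => ∑ i ∈ S, v i)] at this
      simpa using this
    · have hbR : (0 : ℝ) < b := by exact_mod_cast hb
      have hs : (fun _ : Fin b => ∑ i ∈ S, v i) =
          fun _ => (b : ℝ) • ((b : ℝ)⁻¹ • ∑ i ∈ S, v i) := by
        funext _
        rw [smul_inv_smul₀ hbR.ne']
      rw [hs, ContinuousMultilinearMap.map_smul_univ, norm_smul]
      simp only [Finset.prod_const, Finset.card_univ, Fintype.card_fin, norm_pow,
        Real.norm_natCast]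
      gcongr
      refine hK _ ?_
      have : ∑ i, |(∑ j ∈ S, v j) i| ≤ b := by
        calc ∑ i, |(∑ j ∈ S, v j) i| ≤ ∑ i, ∑ j ∈ S, |v j i| := by
              refine Finset.sum_le_sum fun i _ => ?_
              rw [WithLp.ofLp_sum, Finset.sum_apply]
              exact Finset.abs_sum_le_sum_abs _ _
          _ = ∑ j ∈ S, ∑ i, |v j i| := Finset.sum_comm
          _ = ∑ j ∈ S, 1 := by
              refine Finset.sum_congr rfl fun j _ => ?_
              simp [hv, apply_ite abs]
          _ ≤ b := by
              simpa using S.card_le_univ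
      simp only [PiLp.smul_apply, smul_eq_mul, abs_mul, abs_inv, Nat.abs_cast, ← Finset.mul_sum]
      rw [inv_mul_le_iff₀ hbR]
      linarith
  have hle : (b.factorial : ℝ) * ‖T v‖ ≤ 2 ^ b * ((b : ℝ) ^ b * K) := by
    calc (b.factorial : ℝ) * ‖T v‖ = ‖(-1 : ℝ) ^ b • b.factorial • T v‖ := by
          rw [norm_smul, nsmul_eq_mul, norm_mul]
          simp
      _ ≤ ∑ _S : Finset (Fin b), (b : ℝ) ^ b * K := by
          rw [← hpol]
          refine norm_sum_le_of_le _ fun S _ => ?_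
          rw [norm_smul]
          simpa using hdiag S
      _ = _ := by simp
  have hfac : (b : ℝ) ^ b / b.factorial ≤ Real.exp 1 ^ b := by
    rw [← Real.exp_nat_mul, mul_one]
    exact Real.pow_div_factorial_le_exp _ b.cast_nonneg b
  have hf0 : (0 : ℝ) < b.factorial := by positivity
  calc ‖T v‖ ≤ 2 ^ b * ((b : ℝ) ^ b * K) / b.factorial := by
        rw [le_div_iff₀ hf0]
        linarith
    _ = 2 ^ b * ((b : ℝ) ^ b / b.factorial) * K := by ring
    _ ≤ 2 ^ b * Real.exp 1 ^ b * K := by gcongr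
    _ = _ := by rw [mul_pow]

end PartialDerivatives

/-! ### Mixed bounds from two pure bounds -/

section MixedBounds

variable {𝕜 : Type*} [RCLike 𝕜] {n : ℕ} {f : EuclideanSpace ℝ (Fin n) → 𝕜}

theorem abs_multiMonomial_le (α : Fin n → ℕ) (x : EuclideanSpace ℝ (Fin n)) :
    |multiMonomial α x| ≤ ‖x.ofLp‖ ^ multiLength α := by
  rw [multiMonomial, Finset.abs_prod, multiLength, ← Finset.prod_pow_eq_pow_sum]
  refine Finset.prod_le_prod (fun _ _ => abs_nonneg _) fun i _ => ?_
  rw [abs_pow]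
  gcongr
  exact norm_le_pi_norm x.ofLp i

theorem exists_abs_multiMonomial_eq {x : EuclideanSpace ℝ (Fin n)} (hx : 0 < ‖x.ofLp‖) (Q : ℕ) :
    ∃ α : Fin n → ℕ, multiLength α = Q ∧ |multiMonomial α x| = ‖x.ofLp‖ ^ Q := by
  have hne : Nonempty (Fin n) := by
    by_contra h
    rw [not_nonempty_iff] at h
    exact hx.ne' (by rw [Subsingleton.elim x.ofLp 0, norm_zero])
  obtain ⟨i, hi⟩ := Finite.exists_max fun i => ‖x.ofLp i‖
  have hxi : ‖x.ofLp‖ = |x.ofLp i| :=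
    le_antisymm ((pi_norm_le_iff_of_nonempty _).mpr hi) (norm_le_pi_norm x.ofLp i)
  refine ⟨Pi.single i Q, ?_, ?_⟩
  · simp [multiLength]
  · rw [multiMonomial, Finset.prod_eq_single i]
    · rw [Pi.single_eq_same, abs_pow, hxi]
    · intro j _ hj
      rw [Pi.single_eq_of_ne hj, pow_zero]
    · simp

/-- In the sup norm, if `|x| ≥ 2` then every `y` within distance `1` has `|y| ≥ |x| / 2`, so `‖f y‖
≤ C (2R / |x|)^Q`; half of this exponent already compensates `|x|^a`. If `|x| < 2`, `ε = C`
suffices. -/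
theorem exists_local_bound {C R : ℝ} (hC : 0 < C) (hR : 0 < R) {a Q : ℕ} (haQ : 2 * a ≤ Q)
    (h0 : ∀ y, ‖f y‖ ≤ C)
    (hQ : ∀ α : Fin n → ℕ, multiLength α = Q → ∀ y, |multiMonomial α y| * ‖f y‖ ≤ C * R ^ Q)
    (x : EuclideanSpace ℝ (Fin n)) :
    ∃ ε, 0 < ε ∧ ε ≤ C ∧ (∀ y : EuclideanSpace ℝ (Fin n), ‖(y - x).ofLp‖ ≤ 1 → ‖f y‖ ≤ ε) ∧
      ‖x.ofLp‖ ^ a * √(C * ε) ≤ C * max (2 * R) 2 ^ a := by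
  set t := ‖x.ofLp‖ with ht
  have ht0 : 0 ≤ t := norm_nonneg _
  rcases lt_or_ge t 2 with h2 | h2
  · refine ⟨C, hC, le_rfl, fun y _ => h0 y, ?_⟩
    rw [Real.sqrt_mul_self hC.le, mul_comm]
    gcongr
    exact h2.le.trans (le_max_right _ _)
  · have htpos : 0 < t := by linarith
    -- The cap at `1` ensures `ε ≤ C` and lets the exponent `Q` be lowered to `2a`.
    set u := min 1 (2 * R / t) with hu
    have hu0 : 0 < u := lt_min one_pos (by positivity)
    have hu1 : u ≤ 1 := min_le_left _ _
    refine ⟨C * u ^ Q, by positivity, mul_le_of_le_one_right hC.le (pow_le_one₀ hu0.le hu1),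
      fun y hy => ?_, ?_⟩
    · rcases min_choice 1 (2 * R / t) with h | h
      · rw [hu, h, one_pow, mul_one]
        exact h0 y
      · have hyt : t / 2 ≤ ‖y.ofLp‖ := by
          have h3 := norm_sub_norm_le x.ofLp y.ofLp
          rw [WithLp.ofLp_sub, norm_sub_rev] at hy
          linarith
        have hypos : 0 < ‖y.ofLp‖ := by linarith
        obtain ⟨α, hα, hαy⟩ := exists_abs_multiMonomial_eq hypos Q
        have h4 := hQ α hα y
        rw [hαy] at h4
        rw [hu, h]
        have h5 : (t / 2) ^ Q * ‖f y‖ ≤ C * R ^ Q := le_trans (by gcongr) h4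
        rw [show 2 * R / t = R / (t / 2) by field_simp, div_pow, ← mul_div_assoc,
          le_div_iff₀ (by positivity), mul_comm]
        exact h5
    · have hs : √(C * (C * u ^ Q)) ≤ C * u ^ a := by
        refine Real.sqrt_le_iff.mpr ⟨by positivity, ?_⟩
        calc C * (C * u ^ Q) ≤ C * (C * u ^ (2 * a)) := by
              gcongr ?_ * (?_ * ?_)
              exact pow_le_pow_of_le_one hu0.le hu1 haQ
          _ = (C * u ^ a) ^ 2 := by ring
      calc t ^ a * √(C * (C * u ^ Q)) ≤ t ^ a * (C * u ^ a) := by gcongr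
        _ = C * (t * u) ^ a := by rw [mul_pow]; ring
        _ ≤ C * max (2 * R) 2 ^ a := by
          gcongr
          refine le_trans ?_ (le_max_left _ _)
          calc t * u ≤ t * (2 * R / t) := by gcongr; exact min_le_right _ _
            _ = 2 * R := by field_simp

/-- The one-dimensional inequality is applied on the lines `t ↦ f (x + t • v)` with `∑ |v i| ≤ 1`.
The constant `e^4` is `e` from polarization times `e^3` from interpolation. -/
theorem abs_multiMonomial_mul_norm_multiDeriv_le (hf : ContDiff ℝ ∞ f) {C R S : ℝ} (hC : 0 < C)
    (hR : 0 < R) (hS : 0 < S) {α β : Fin n → ℕ} {Q N : ℕ} (hαQ : 2 * multiLength α ≤ Q)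
    (hN1 : 1 ≤ N) (hβN : 2 * multiLength β ≤ N) (h0 : ∀ y, ‖f y‖ ≤ C)
    (hQ : ∀ α : Fin n → ℕ, multiLength α = Q → ∀ y, |multiMonomial α y| * ‖f y‖ ≤ C * R ^ Q)
    (hN : ∀ β : Fin n → ℕ, multiLength β = N → ∀ y, ‖multiDeriv β f y‖ ≤ C * S ^ N)
    (x : EuclideanSpace ℝ (Fin n)) :
    |multiMonomial α x| * ‖multiDeriv β f x‖ ≤
      2 * C * (max (2 * R) 2 ^ multiLength α * (2 * Real.exp 4 * max S N) ^ multiLength β) := by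
  obtain ⟨ε, hε0, hεC, hε, hxε⟩ := exists_local_bound hC hR hαQ h0 hQ x
  have hmax : 0 < max S (N : ℝ) := lt_max_of_lt_left hS
  have hder := norm_multiDeriv_le_of_diagonal hf (x := x) (β := β)
    (K := 2 * (Real.exp 3 * max S N) ^ multiLength β * √(C * ε)) (by positivity) (by
      intro v hv
      have hcomp := iteratedDeriv_comp_line hf x v
      have h := norm_iteratedDeriv_le_sqrt (g := fun t : ℝ => f (x + t • v)) (by fun_prop)
        hε0 hεC hS hN1 hβN ?_ ?_
      · rw [hcomp] at h
        simpa using h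
      · intro t ht
        refine hε _ ?_
        rw [add_sub_cancel_left, WithLp.ofLp_smul, norm_smul, Real.norm_eq_abs]
        refine mul_le_one₀ ht (norm_nonneg _) ?_
        refine (pi_norm_le_iff_of_nonneg zero_le_one).mpr fun i => le_trans ?_ hv
        exact Finset.single_le_sum (f := fun i => |v i|) (fun _ _ => abs_nonneg _)
          (Finset.mem_univ i)
      · intro t _
        rw [hcomp]
        exact norm_iteratedFDeriv_diagonal_le hf (fun β hβ => hN β hβ _) hv (by positivity))
  calc |multiMonomial α x| * ‖multiDeriv β f x‖
      ≤ ‖x.ofLp‖ ^ multiLength α * ((2 * Real.exp 1) ^ multiLength β *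
        (2 * (Real.exp 3 * max S N) ^ multiLength β * √(C * ε))) := by
        gcongr
        exact abs_multiMonomial_le α x
    _ = 2 * (2 * Real.exp 4 * max S N) ^ multiLength β *
        (‖x.ofLp‖ ^ multiLength α * √(C * ε)) := by
        rw [show (4 : ℝ) = 1 + 3 by norm_num, Real.exp_add]
        simp only [mul_pow]
        ring
    _ ≤ 2 * (2 * Real.exp 4 * max S N) ^ multiLength β * (C * max (2 * R) 2 ^ multiLength α) := by
        gcongr
    _ = _ := by ring

end MixedBounds

/-! ### Weight sequences and the choice of lacunary orders -/

section WeightSequences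

variable {M : ℕ → ℝ}

theorem weightRoot_zero (M : ℕ → ℝ) : weightRoot M 0 = 1 := by
  simp [weightRoot]

theorem IsWeightSequence.weightRoot_pos (hM : IsWeightSequence M) (j : ℕ) : 0 < weightRoot M j :=
  Real.rpow_pos_of_pos (hM.pos j) _

theorem IsWeightSequence.weightRoot_pow (hM : IsWeightSequence M) (j : ℕ) :
    weightRoot M j ^ j = M j := by
  rcases eq_or_ne j 0 with rfl | hj
  · rw [pow_zero, hM.zero]
  · rw [weightRoot, one_div, Real.rpow_inv_natCast_pow (hM.pos j).le hj]

/-- `M j` is a product of `j` quotients, each at most the next one, `M (j + 1) / M j`. -/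
theorem IsWeightSequence.le_quot_pow (hM : IsWeightSequence M) (j : ℕ) :
    M j ≤ (M (j + 1) / M j) ^ j := by
  induction j with
  | zero => simp [hM.zero]
  | succ j ih =>
    have hq : 0 < M (j + 1) / M j := div_pos (hM.pos _) (hM.pos _)
    calc M (j + 1) = M j * (M (j + 1) / M j) := by
          rw [mul_div_cancel₀ _ (hM.pos j).ne']
      _ ≤ (M (j + 1) / M j) ^ j * (M (j + 1) / M j) := by gcongr
      _ = (M (j + 1) / M j) ^ (j + 1) := (pow_succ _ _).symm
      _ ≤ _ := by
        gcongr ?_ ^ _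
        exact hM.quot_mono j

theorem IsWeightSequence.monotone_weightRoot (hM : IsWeightSequence M) :
    Monotone (weightRoot M) := by
  refine monotone_nat_of_le_succ fun j => ?_
  rcases eq_or_ne j 0 with rfl | hj
  · simpa [weightRoot] using hM.one_le
  · have h1 : M j ^ (j + 1) ≤ M (j + 1) ^ j := by
      calc M j ^ (j + 1) = M j ^ j * M j := pow_succ _ _
        _ ≤ M j ^ j * (M (j + 1) / M j) ^ j := by
          gcongr
          · exact (pow_pos (hM.pos j) j).le
          · exact hM.le_quot_pow j
        _ = M (j + 1) ^ j := by
          rw [← mul_pow, mul_div_cancel₀ _ (hM.pos j).ne']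
    refine le_of_pow_le_pow_left₀ (n := j * (j + 1)) (by positivity)
      (hM.weightRoot_pos _).le ?_
    rw [pow_mul, hM.weightRoot_pow, mul_comm j, pow_mul, hM.weightRoot_pow]
    exact h1

theorem IsWeightSequence.one_le_weightRoot (hM : IsWeightSequence M) (j : ℕ) :
    1 ≤ weightRoot M j := by
  rw [← weightRoot_zero M]
  exact hM.monotone_weightRoot j.zero_le

theorem IsWeightSequence.exists_weightRoot_two_mul_le (hM : IsWeightSequence M)
    (hmg : HasModerateGrowth M) :
    ∃ A > 0, ∀ c, weightRoot M (2 * c) ≤ A * weightRoot M c := by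
  obtain ⟨C, hC⟩ := hmg
  refine ⟨max C 1, by positivity, fun c => ?_⟩
  have hmc := hM.weightRoot_pos c
  rcases Nat.eq_zero_or_pos c with rfl | hc
  · simp [weightRoot_zero]
  have h := hC c c hc hc
  have hcc : (c : ℝ) + c = ((2 * c : ℕ) : ℝ) := by
    push_cast
    ring
  have hMM : M (c + c) / (M c * M c) = (weightRoot M (2 * c) / weightRoot M c) ^ (2 * c) := by
    rw [div_pow, hM.weightRoot_pow, mul_comm 2 c, pow_mul, hM.weightRoot_pow, sq, mul_two]
  rw [hcc, hMM, one_div, Real.pow_rpow_inv_natCast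
    (div_pos (hM.weightRoot_pos _) hmc).le (by omega), div_le_iff₀ hmc] at h
  exact h.trans (by gcongr; exact le_max_left _ _)

theorem IsWeightSequence.exists_index (hM : IsWeightSequence M) (hmg : HasModerateGrowth M)
    {k : ℕ → ℕ} (hk : IsBaseSequence k)
    (hkM : BddAbove (Set.range fun j : ℕ => weightRoot M (k (j + 1)) / weightRoot M (k j))) :
    ∃ H > 0, ∀ c, ∃ j, 1 ≤ k j ∧ 2 * c ≤ k j ∧ weightRoot M (k j) ≤ H * weightRoot M c := by
  obtain ⟨A, hA0, hA⟩ := hM.exists_weightRoot_two_mul_le hmg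
  obtain ⟨B, hB⟩ := hkM
  have hB' : ∀ j, weightRoot M (k (j + 1)) ≤ B * weightRoot M (k j) := fun j =>
    (div_le_iff₀ (hM.weightRoot_pos _)).mp (hB (Set.mem_range_self j))
  have hB0 : 0 < B :=
    (div_pos (hM.weightRoot_pos _) (hM.weightRoot_pos _)).trans_le (hB (Set.mem_range_self 0))
  refine ⟨B * A, by positivity, fun c => ?_⟩
  -- For the least such `j`, `k j ≤ 2c` (also when `j = 0`, as `k 0 = 0`), so one bounded ratio and
  -- one doubling of `c` give `H = B * A`.
  have hex : ∃ j, 2 * c ≤ k (j + 1) :=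
    ⟨2 * c, (Nat.le_succ _).trans hk.strictMono.le_apply⟩
  classical
  set j := Nat.find hex with hj
  have hkj : k j ≤ 2 * c := by
    rcases Nat.eq_zero_or_pos j with h | h
    · rw [h, hk.zero]
      exact Nat.zero_le _
    · have := Nat.find_min hex (m := j - 1) (by omega)
      rw [Nat.sub_add_cancel h] at this
      omega
  refine ⟨j + 1, ?_, Nat.find_spec hex, ?_⟩
  · exact (Nat.succ_le_succ (Nat.zero_le j)).trans hk.strictMono.le_apply
  · calc weightRoot M (k (j + 1)) ≤ B * weightRoot M (k j) := hB' j
      _ ≤ B * weightRoot M (2 * c) := by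
        gcongr
        exact hM.monotone_weightRoot hkj
      _ ≤ B * (A * weightRoot M c) := by
        gcongr
        exact hA c
      _ = _ := by ring

end WeightSequences

/-! ### Comparison of the classes -/

section Classes

variable {𝕜 : Type*} [RCLike 𝕜] {n : ℕ} {f : EuclideanSpace ℝ (Fin n) → 𝕜} {M : ℕ → ℝ}
  {k l : ℕ → ℕ}

theorem multiDeriv_eq_self {β : Fin n → ℕ} (hβ : multiLength β = 0)
    (f : EuclideanSpace ℝ (Fin n) → 𝕜) : multiDeriv β f = f := by
  rw [multiDeriv_eq_foldr, List.eq_nil_of_length_eq_zero ((length_multiIndexList β).trans hβ),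
    List.foldr_nil]

theorem LacunaryBound.norm_le {C ρ σ : ℝ} (hl : IsBaseSequence l)
    (h : LacunaryBound M k l C ρ σ f) (x : EuclideanSpace ℝ (Fin n)) : ‖f x‖ ≤ C := by
  have hz : multiLength (0 : Fin n → ℕ) = 0 := by simp [multiLength]
  have := (h 0).2 0 (by rw [hz, hl.zero]) x
  rwa [multiDeriv_eq_self hz, hl.zero, pow_zero, mul_one] at this

theorem GelfandShilovBound.exists_lacunaryBound (hM : IsWeightSequence M) {ρ σ : ℝ} (hρ : 0 < ρ)
    (hσ : 0 < σ) (h : GelfandShilovBound M ρ σ f) (k l : ℕ → ℕ) :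
    ∃ C > 0, LacunaryBound M k l C ρ σ f := by
  obtain ⟨C, hC⟩ := h
  have hz : multiLength (0 : Fin n → ℕ) = 0 := by simp [multiLength]
  have hmono : ∀ x : EuclideanSpace ℝ (Fin n), multiMonomial 0 x = 1 := fun x => by
    simp [multiMonomial]
  have hpos : ∀ {τ : ℝ}, 0 < τ → ∀ j, 0 < (τ * weightRoot M j) ^ j := fun hτ j =>
    pow_pos (mul_pos hτ (hM.weightRoot_pos j)) j
  refine ⟨max C 1, by positivity, fun j => ⟨fun α hα x => ?_, fun β hβ x => ?_⟩⟩
  · have h1 := hC α 0 x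
    rw [multiDeriv_eq_self hz, hz, pow_zero, mul_one, hα, div_le_iff₀ (hpos hρ _)] at h1
    exact h1.trans (mul_le_mul_of_nonneg_right (le_max_left _ _) (hpos hρ _).le)
  · have h1 := hC 0 β x
    rw [hmono, abs_one, one_mul, hz, pow_zero, one_mul, hβ, div_le_iff₀ (hpos hσ _)] at h1
    exact h1.trans (mul_le_mul_of_nonneg_right (le_max_left _ _) (hpos hσ _).le)

theorem LacunaryBound.mixed_bound (hM : IsWeightSequence M) (hl : IsBaseSequence l)
    (hf : ContDiff ℝ ∞ f) {C ρ σ H H' : ℝ} (hC : 0 < C) (hρ : 0 < ρ) (hσ : 0 < σ) (hH : 0 < H)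
    (hH' : 0 < H') (h : LacunaryBound M k l C ρ σ f) {α β : Fin n → ℕ} {i j : ℕ}
    (hki : 2 * multiLength α ≤ k i)
    (hmi : weightRoot M (k i) ≤ H * weightRoot M (multiLength α))
    (hlj1 : 1 ≤ l j) (hlj : 2 * multiLength β ≤ l j)
    (hmj : weightRoot M (l j) ≤ H' * weightRoot M (multiLength β))
    (x : EuclideanSpace ℝ (Fin n)) :
    |multiMonomial α x| * ‖multiDeriv β f x‖ ≤
      2 * C * (max (2 * (ρ * (H * weightRoot M (multiLength α)))) 2 ^ multiLength α *
        (2 * Real.exp 4 * max (σ * (H' * weightRoot M (multiLength β))) (l j)) ^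
          multiLength β) := by
  have hp := hM.weightRoot_pos
  refine abs_multiMonomial_mul_norm_multiDeriv_le hf hC
    (mul_pos hρ (mul_pos hH (hp _))) (mul_pos hσ (mul_pos hH' (hp _))) hki hlj1 hlj
    (h.norm_le hl) (fun α hα y => ((h i).1 α hα y).trans ?_)
    (fun β hβ y => ((h j).2 β hβ y).trans ?_) x
  · have := hp (k i)
    gcongr
  · have := hp (l j)
    gcongr

theorem exists_forall_le_mul_of_eventually_le {u v : ℕ → ℝ} (hv : ∀ a, 0 < v a)
    (h : ∀ᶠ a in atTop, u a ≤ v a) : ∃ D > 0, ∀ a, u a ≤ D * v a := by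
  have hb : Filter.IsBoundedUnder (· ≤ ·) atTop fun a => u a / v a :=
    ⟨1, eventually_map.mpr (h.mono fun a ha => (div_le_one (hv a)).mpr ha)⟩
  obtain ⟨D, hD⟩ := hb.bddAbove_range
  refine ⟨max D 1, by positivity, fun a => ?_⟩
  rw [← div_le_iff₀ (hv a)]
  exact (hD (Set.mem_range_self a)).trans (le_max_left _ _)

theorem LacunaryBound.exists_gelfandShilovBound (hk : IsBaseSequence k) (hl : IsBaseSequence l)
    (hM : IsWeightSequence M) (hmg : HasModerateGrowth M)
    (hkM : BddAbove (Set.range fun j : ℕ => weightRoot M (k (j + 1)) / weightRoot M (k j)))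
    (hlM : BddAbove (Set.range fun j : ℕ => weightRoot M (l (j + 1)) / weightRoot M (l j)))
    (hbdd : BddAbove (Set.range fun j : ℕ => (j : ℝ) / weightRoot M j))
    (hf : ContDiff ℝ ∞ f) {C ρ σ : ℝ} (hC : 0 < C) (hρ : 0 < ρ) (hσ : 0 < σ)
    (h : LacunaryBound M k l C ρ σ f) :
    ∃ ρ' > 0, ∃ σ' > 0, GelfandShilovBound M ρ' σ' f := by
  obtain ⟨H, hH, hki⟩ := hM.exists_index hmg hk hkM
  obtain ⟨H', hH', hlj⟩ := hM.exists_index hmg hl hlM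
  obtain ⟨B, hB⟩ := hbdd
  have hp := hM.weightRoot_pos
  have hB' : ∀ j : ℕ, (j : ℝ) ≤ B * weightRoot M j := fun j =>
    (div_le_iff₀ (hp _)).mp (hB (Set.mem_range_self j))
  have hB0 : 0 ≤ B := by simpa using hB (Set.mem_range_self 0)
  refine ⟨max (2 * (ρ * H)) 2, by positivity, 2 * Real.exp 4 * max (σ * H') (B * H'),
    mul_pos (by positivity) (lt_max_of_lt_left (by positivity)), 2 * C, fun α β x => ?_⟩
  obtain ⟨i, -, hi2, hi3⟩ := hki (multiLength α)
  obtain ⟨j, hj1, hj2, hj3⟩ := hlj (multiLength β)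
  have hα := hp (multiLength α)
  have hβ := hp (multiLength β)
  have hmax : 0 < max (σ * H') (B * H') := lt_max_of_lt_left (by positivity)
  rw [div_le_iff₀ (by positivity)]
  refine (h.mixed_bound hM hl hf hC hρ hσ hH hH' hi2 hi3 hj1 hj2 hj3 x).trans ?_
  gcongr ?_ * (?_ ^ _ * ?_ ^ _)
  · rw [max_mul_of_nonneg _ _ hα.le]
    refine max_le_max (by ring_nf; rfl) ?_
    linarith [hM.one_le_weightRoot (multiLength α)]
  · rw [mul_assoc (2 * Real.exp 4), max_mul_of_nonneg _ _ hβ.le]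
    gcongr 2 * Real.exp 4 * ?_
    -- The order `l j` itself enters the constant; it is at most `B * m_{l j} ≤ B * H' * m_b`, where
    -- `b = |β|`.
    refine max_le_max (by ring_nf; rfl) ((hB' _).trans ?_)
    rw [mul_assoc]
    gcongr

theorem gelfandShilovBound_of_forall_lacunaryBound (hk : IsBaseSequence k) (hl : IsBaseSequence l)
    (hM : IsWeightSequence M) (hmg : HasModerateGrowth M)
    (hkM : BddAbove (Set.range fun j : ℕ => weightRoot M (k (j + 1)) / weightRoot M (k j)))
    (hlM : BddAbove (Set.range fun j : ℕ => weightRoot M (l (j + 1)) / weightRoot M (l j)))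
    (hlim : Tendsto (fun j : ℕ => (j : ℝ) / weightRoot M j) atTop (𝓝 0))
    (hf : ContDiff ℝ ∞ f)
    (h : ∀ ρ > 0, ∀ σ > 0, ∃ C > 0, LacunaryBound M k l C ρ σ f) {ρ σ : ℝ} (hρ : 0 < ρ)
    (hσ : 0 < σ) : GelfandShilovBound M ρ σ f := by
  obtain ⟨H, hH, hki⟩ := hM.exists_index hmg hk hkM
  obtain ⟨H', hH', hlj⟩ := hM.exists_index hmg hl hlM
  choose j hj1 hj2 hj3 using hlj
  have hp := hM.weightRoot_pos
  have hsmall : ∀ η > 0, ∀ᶠ a : ℕ in atTop, (a : ℝ) ≤ η * weightRoot M a := fun η hη =>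
    (hlim.eventually_le_const hη).mono fun a ha => (div_le_iff₀ (hp a)).mp ha
  -- These values make the constants of `mixed_bound` exactly `ρ` and `σ` once the first entry of
  -- each maximum dominates, as it does or may be assumed to do for large orders; `D₁` and `D₂`
  -- absorb the other orders.
  set ρ₀ := ρ / (2 * H) with hρ₀
  set σ₀ := σ / (2 * Real.exp 4 * H') with hσ₀
  have hρ₀pos : 0 < ρ₀ := by positivity
  have hσ₀pos : 0 < σ₀ := by positivity
  obtain ⟨C, hC, hlac⟩ := h ρ₀ hρ₀pos σ₀ hσ₀pos
  obtain ⟨D₁, hD₁, hD₁le⟩ := exists_forall_le_mul_of_eventually_le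
    (u := fun a => max (2 * (ρ₀ * (H * weightRoot M a))) 2 ^ a)
    (v := fun a => (ρ * weightRoot M a) ^ a) (fun a => pow_pos (mul_pos hρ (hp a)) a) (by
      filter_upwards [hsmall (ρ / 2) (by positivity), eventually_ge_atTop 1] with a ha ha1
      have ha2 : (1 : ℝ) ≤ a := by exact_mod_cast ha1
      refine pow_le_pow_left₀ (by positivity) (max_le (le_of_eq ?_) ?_) a
      · rw [hρ₀]
        field_simp
      · linarith)
  obtain ⟨D₂, hD₂, hD₂le⟩ := exists_forall_le_mul_of_eventually_le
    (u := fun b => (2 * Real.exp 4 * max (σ₀ * (H' * weightRoot M b)) (l (j b))) ^ b)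
    (v := fun b => (σ * weightRoot M b) ^ b) (fun b => pow_pos (mul_pos hσ (hp b)) b) (by
      obtain ⟨N₀, hN₀⟩ := eventually_atTop.mp (hsmall σ₀ hσ₀pos)
      filter_upwards [eventually_ge_atTop N₀] with b hb
      -- Smallness of `a / m_a` is used at `a = l (j b) ≥ 2b ≥ N₀`, not at `b`.
      have hN : (l (j b) : ℝ) ≤ σ₀ * (H' * weightRoot M b) :=
        (hN₀ _ (by linarith [hj2 b])).trans (by gcongr; exact hj3 b)
      rw [max_eq_left hN]
      refine le_of_eq (congrArg (· ^ b) ?_)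
      rw [hσ₀]
      field_simp)
  refine ⟨2 * C * (D₁ * D₂), fun α β x => ?_⟩
  obtain ⟨i, -, hi2, hi3⟩ := hki (multiLength α)
  have hα := hp (multiLength α)
  have hβ := hp (multiLength β)
  rw [div_le_iff₀ (by positivity)]
  refine (hlac.mixed_bound hM hl hf hC hρ₀pos hσ₀pos hH hH' hi2 hi3 (hj1 _) (hj2 _) (hj3 _)
    x).trans ?_
  rw [mul_assoc (2 * C), mul_mul_mul_comm D₁]
  refine mul_le_mul_of_nonneg_left (mul_le_mul (hD₁le _) (hD₂le _) ?_ ?_) (by positivity)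
  · exact pow_nonneg (mul_nonneg (by positivity) (le_max_of_le_right (Nat.cast_nonneg _))) _
  · positivity

end Classes

theorem mainTheorem2 {𝕜 : Type*} [RCLike 𝕜] (n : ℕ) (k l : ℕ → ℕ) (M : ℕ → ℝ)
    (hk : IsBaseSequence k) (hl : IsBaseSequence l)
    (hM : IsWeightSequence M) (hmg : HasModerateGrowth M)
    (hkM : BddAbove (Set.range fun j : ℕ => weightRoot M (k (j + 1)) / weightRoot M (k j)))
    (hlM : BddAbove (Set.range fun j : ℕ => weightRoot M (l (j + 1)) / weightRoot M (l j))) :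
    (BddAbove (Set.range fun j : ℕ => (j : ℝ) / weightRoot M j) →
      lacunaryGelfandShilovRoumieu 𝕜 n M k l = gelfandShilovRoumieu 𝕜 n M) ∧
    (Tendsto (fun j : ℕ => (j : ℝ) / weightRoot M j) atTop (𝓝 0) →
      lacunaryGelfandShilovBeurling 𝕜 n M k l = gelfandShilovBeurling 𝕜 n M) := by
  refine ⟨fun hbdd => Set.ext fun f => ⟨?_, ?_⟩, fun hlim => Set.ext fun f => ⟨?_, ?_⟩⟩
  · rintro ⟨hf, C, hC, ρ, hρ, σ, hσ, h⟩
    exact ⟨hf, h.exists_gelfandShilovBound hk hl hM hmg hkM hlM hbdd hf hC hρ hσ⟩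
  · rintro ⟨hf, ρ, hρ, σ, hσ, h⟩
    obtain ⟨C, hC, hlac⟩ := h.exists_lacunaryBound hM hρ hσ k l
    exact ⟨hf, C, hC, ρ, hρ, σ, hσ, hlac⟩
  · rintro ⟨hf, h⟩
    exact ⟨hf, fun ρ hρ σ hσ =>
      gelfandShilovBound_of_forall_lacunaryBound hk hl hM hmg hkM hlM hlim hf h hρ hσ⟩
  · rintro ⟨hf, h⟩
    exact ⟨hf, fun ρ hρ σ hσ => (h ρ hρ σ hσ).exists_lacunaryBound hM hρ hσ k l⟩
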